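/- **Model.** There are $n$ players and a set $M$ of $m$ indivisible items. A valuation is a monotone function $v:2^M\to\mathbb R_{\ge 0}$ with $v(\emptyset)=0$ and $v(M)>0$; it is submodular if $v(T\cup\{g\})-v(T)\le v(S\cup\{g\})-v(S)$ whenever $S\subseteq T\subseteq M$ and $g\in M$. An allocation is a partition $(A_1,\dots,A_n)$ of $M$ into labelled, possibly empty bundles; for $c\in[0,1]$ it is $c$-Prop if $v_i(A_i)\ge c\,v_i(M)/n$ for every player $i$. Player $i$ knows only $v_i$. In a protocol the players send bits seen by all players; who speaks depends on the messages so far, and each bit depends on these and on the speaker's valuation; the protocol ends when a player declares the answer (the declaration is not charged). In a public-coin randomized protocol the players moreover all see infinite streams of independent fair random bits, on which everything may depend. Such a protocol is correct if on every tuple of valuations of the given class its answer is right with probability at least $2/3$; its cost is the maximum number of bits sent, over all such tuples and all coins. Let $R_{submod}(n,m,\mathrm{Prop},c)$ be the minimum cost of a correct randomized protocol that, for $n$ players with submodular valuations on $m$ items, either finds a $c$-Prop allocation or reports that none exists, and let $R^{dec}_{submod}(n,m,\mathrm{Prop},c)$ be the minimum cost of a correct randomized protocol that only decides whether a $c$-Prop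 allocation exists. **Theorem.** For any $n>2$ and any $c$ with $0<c\le 1$, any randomized protocol which determines whether a $c$-Prop allocation exists requires an exponential amount of communication, even for submodular valuations. Specifically, $$R^{dec}_{submod}(n,2k+n-2,\mathrm{Prop},c)\in\Omega\!\left(\binom{2k}{k}\right),\qquad R_{submod}(n,2k+n-2,\mathrm{Prop},c)\in\Omega\!\left(\binom{2k}{k}\right):$$ there are an absolute constant $C>0$ and an absolute $K$ such that both quantities are at least $C\binom{2k}{k}$ for all $n>2$, all $0<c\le1$ and all $k\ge K$. The same bound holds for the decision problem when only players $1$ and $2$ have private valuations: for all such $n,c,k$, with $m=2k+n-2$, there are a set $L\subset\mathbb R$ of at most $m$ numbers and publicly known valuations of players $3,\dots,n$ for which any randomized protocol that is correct whenever the valuations of all players are submodular and have all their values in $L$ has cost at least $C\binom{2k}{k}$ on these inputs. -/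

import Mathlib

open scoped ENNReal NNReal

noncomputable section

namespace FairDivision

/-! ### Fair division -/

/-- A valuation on the bundles of a set of `m` items: nonnegative, monotone, normalized, and
giving the set of all items a positive value. -/
structure Valuation (m : ℕ) where
  val : Finset (Fin m) → ℝ
  nonneg : ∀ S, 0 ≤ val S
  mono : ∀ S T, S ⊆ T → val S ≤ val T
  normalized : val ∅ = 0
  total_pos : 0 < val Finset.univ

/-- Diminishing marginal values. -/
def Valuation.Submodular {m : ℕ} (v : Valuation m) : Prop :=
  ∀ (S T : Finset (Fin m)) (g : Fin m), S ⊆ T →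
    v.val (insert g T) - v.val T ≤ v.val (insert g S) - v.val S

/-- An allocation of `m` items to `n` players (a partition of the items into `n` labelled, possibly
empty bundles), given by the owner of each item. -/
abbrev Allocation (n m : ℕ) : Type := Fin m → Fin n

/-- The bundle that player `i` receives. -/
def Allocation.bundle {n m : ℕ} (A : Allocation n m) (i : Fin n) : Finset (Fin m) :=
  Finset.univ.filter fun g => A g = i

/-- The allocation `A` is `c`-Prop: each player gets at least `c / n` times her value for the
set of all items. -/
def IsProp {n m : ℕ} (c : ℝ) (v : Fin n → Valuation m) (A : Allocation n m) : Prop :=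
  ∀ i, c * ((v i).val Finset.univ / n) ≤ (v i).val (A.bundle i)

/-- `PropSearch c v o`: the answer `o` is right for the search problem, that is, `o` is a `c`-Prop
allocation, or `o` is `none` and there is no such allocation. -/
def PropSearch {n m : ℕ} (c : ℝ) (v : Fin n → Valuation m) : Option (Allocation n m) → Prop
  | some A => IsProp c v A
  | none => ¬ ∃ A : Allocation n m, IsProp c v A

/-- `PropDecision c v b`: the answer `b` is right for the problem of deciding whether a `c`-Prop
allocation exists. -/
def PropDecision {n m : ℕ} (c : ℝ) (v : Fin n → Valuation m) (b : Bool) : Prop :=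
  b = true ↔ ∃ A : Allocation n m, IsProp c v A

/-! ### Communication complexity -/

/-- A deterministic `n`-party protocol; each player holds a private input in `X`, the answer is in
`O`, and all messages are seen by all players. The position in the tree is the history of messages.
At a node `speak i f next`, player `i` sends one bit computed from her own input. At a leaf
`declare i f`, player `i` ends the protocol with an answer computed from her own input; the
declaration itself is not charged. -/
inductive Protocol (n : ℕ) (X O : Type) : Type
  | declare (i : Fin n) (f : X → O) : Protocol n X O
  | speak (i : Fin n) (f : X → Bool) (next : Bool → Protocol n X O) : Protocol n X O

namespace Protocol

variable {n : ℕ} {X O : Type}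

/-- The answer declared on the inputs `x`. -/
def answer : Protocol n X O → (Fin n → X) → O
  | declare i f, x => f (x i)
  | speak i f next, x => (next (f (x i))).answer x

/-- The number of bits sent on the inputs `x`. -/
def bits : Protocol n X O → (Fin n → X) → ℕ
  | declare _ _, _ => 0
  | speak i f next, x => (next (f (x i))).bits x + 1

end Protocol

/-- An infinite stream of bits for each of the `n` players. -/
abbrev Coins (n : ℕ) : Type := Fin n × ℕ → Bool

/-- The law of independent fair bits. -/
def coinMeasure (n : ℕ) : MeasureTheory.Measure (Coins n) :=
  MeasureTheory.Measure.infinitePi fun _ => (PMF.uniformOfFintype Bool).toMeasure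

/-- A public-coin randomized protocol: all players see the coins, so that these determine a
deterministic protocol. On each input the answer is required to be a random variable (used for
countable `O`). -/
structure RandProtocol (n : ℕ) (X O : Type) where
  det : Coins n → Protocol n X O
  measurable_answer : ∀ (x : Fin n → X) (o : O), MeasurableSet {ω | (det ω).answer x = o}

namespace RandProtocol

variable {n : ℕ} {X O : Type}

/-- On all inputs with `x i ∈ D i`, the answer is right with probability at least `2 / 3`. -/
def Correct (Γ : RandProtocol n X O) (D : Fin n → Set X) (Right : (Fin n → X) → O → Prop) : Prop :=
  ∀ x : Fin n → X, (∀ i, x i ∈ D i) →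
    2 / 3 ≤ coinMeasure n {ω | Right x ((Γ.det ω).answer x)}

/-- The number of bits sent in the worst case over the inputs with `x i ∈ D i` and the coins. -/
def cost (Γ : RandProtocol n X O) (D : Fin n → Set X) : ℕ∞ :=
  ⨆ (x : Fin n → X) (_ : ∀ i, x i ∈ D i) (ω : Coins n), ((Γ.det ω).bits x : ℕ∞)

end RandProtocol

/-- The randomized communication complexity of a problem on the inputs with `x i ∈ D i`: the
minimum cost of a correct randomized protocol. -/
def randComplexity {n : ℕ} {X O : Type} (D : Fin n → Set X) (Right : (Fin n → X) → O → Prop) : ℕ∞ :=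
  ⨅ (Γ : RandProtocol n X O) (_ : Γ.Correct D Right), Γ.cost D

/-- The randomized complexity of finding a `c`-Prop allocation of `m` items to `n` players with
submodular valuations, or reporting that there is none. -/
def RSubmodProp (n m : ℕ) (c : ℝ) : ℕ∞ :=
  randComplexity (fun _ : Fin n => {v : Valuation m | v.Submodular}) (PropSearch c)

/-- The randomized complexity of deciding whether there is a `c`-Prop allocation of `m` items to
`n` players with submodular valuations. -/
def RSubmodPropDecision (n m : ℕ) (c : ℝ) : ℕ∞ :=
  randComplexity (fun _ : Fin n => {v : Valuation m | v.Submodular}) (PropDecision c)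

/-- The same decision problem when only the first two players have private valuations, those of
the other players being publicly known to be `w`, and all values lie in the set `L`. -/
def RSubmodPropDecisionPublic (n m : ℕ) (c : ℝ) (w : Fin n → Valuation m) (L : Finset ℝ) : ℕ∞ :=
  randComplexity
    (fun i : Fin n => {v : Valuation m |
      v.Submodular ∧ (∀ S, v.val S ∈ L) ∧ (2 ≤ (i : ℕ) → v = w i)})
    (PropDecision c)

end FairDivision

end

/-!
Let the first two players compete for a set `P` of `2 * k` items, where a player who favours a
family `F` of halves of `P` is satisfied with a subset of `P` of size `k` if and only if it belongs
to `F`. The values of the subsets of `P` are capped, and slightly reduced on the halves outside `F`,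
so the valuations are submodular. Since the other players need all the other items, a proportional
allocation splits `P` into a half favoured by the first player and its complement favoured by the
second one, and finding out whether there is such a half is set disjointness on `(2 * k).choose k`
coordinates.

The lower bound for disjointness compares inputs `(w ∩ z, w \ z)` that were changed at one random
coordinate `i`. For a fixed partition `z` the players together hold a uniformly random set `w`, and
by the level-one inequality a transcript of `B` bits depends on the membership of `i` in `w` only by
`O(B)` in squared Hellinger distance, summed over all `i`. As the fibres of the transcript are
rectangles, the two disjoint inputs in which `i` belongs to exactly one of the sets are as far from
each other as the input in which it belongs to both is from the one in which it belongs to neither.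
A correct protocol separates the latter two for every `i`, so `B` is at least linear in the number
of coordinates.
-/

namespace FairDivision

open Finset MeasureTheory Real

section LevelOne

theorem sum_mul_log_div_le {α : Type*} [Fintype α] {p q : α → ℝ} (hp : ∀ a, 0 ≤ p a)
    (hq : ∀ a, 0 < q a) :
    ∑ a, p a * log (q a / p a) ≤ (∑ a, p a) * log ((∑ a, q a) / ∑ a, p a) := by
  set P := ∑ a, p a with hP
  set Q := ∑ a, q a with hQ
  have hP0 : 0 ≤ P := sum_nonneg fun a _ => hp a
  rcases hP0.eq_or_lt with hP0 | hPpos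
  · have hp0 : ∀ a, p a = 0 := fun a =>
      (sum_eq_zero_iff_of_nonneg fun a _ => hp a).1 (hP.symm.trans hP0.symm) a (mem_univ a)
    simp [hp0, ← hP0]
  have hQpos : 0 < Q := by
    obtain ⟨a, -, -⟩ := exists_ne_zero_of_sum_ne_zero hPpos.ne'
    exact sum_pos (fun a _ => hq a) ⟨a, mem_univ a⟩
  have tangent : ∀ a, p a * log (q a / p a) ≤ p a * log (Q / P) + (q a * (P / Q) - p a) := by
    intro a
    rcases (hp a).eq_or_lt with ha | ha
    · have := hq a
      simp only [← ha, zero_mul, zero_add, sub_zero]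
      positivity
    have hsplit : log (q a / p a) = log (Q / P) + log (q a * (P / Q) / p a) := by
      have := hq a
      rw [← log_mul (by positivity) (by positivity)]
      congr 1
      field_simp
    have := log_le_sub_one_of_pos (show 0 < q a * (P / Q) / p a by have := hq a; positivity)
    calc p a * log (q a / p a)
        ≤ p a * (log (Q / P) + (q a * (P / Q) / p a - 1)) := by rw [hsplit]; gcongr
      _ = p a * log (Q / P) + (q a * (P / Q) - p a) := by field_simp
  calc ∑ a, p a * log (q a / p a)
      ≤ ∑ a, (p a * log (Q / P) + (q a * (P / Q) - p a)) := sum_le_sum fun a _ => tangent a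
    _ = P * log (Q / P) + (Q * (P / Q) - P) := by
        rw [sum_add_distrib, sum_sub_distrib, ← sum_mul, ← sum_mul, ← hP, ← hQ]
    _ = P * log (Q / P) := by field_simp; ring

theorem sum_mul_le_mul_log_sum_exp_div {α : Type*} [Fintype α] {p : α → ℝ} (hp0 : ∀ a, 0 ≤ p a)
    (hp1 : ∀ a, p a ≤ 1) (y : α → ℝ) :
    ∑ a, p a * y a ≤ (∑ a, p a) * log ((∑ a, exp (y a)) / ∑ a, p a) := by
  refine (sum_le_sum fun a _ => ?_).trans (sum_mul_log_div_le hp0 fun a => exp_pos (y a))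
  rcases (hp0 a).eq_or_lt with ha | ha
  · simp [← ha]
  · rw [log_div (exp_ne_zero _) ha.ne', log_exp]
    have := log_nonpos ha.le (hp1 a)
    gcongr
    linarith

variable {κ : Type*} [DecidableEq κ]

/-- The coordinate `±1` of the point of the discrete cube with positive part `w`: subsets of `κ`
serve as the points of `{-1, 1}^κ`. -/
def memSign (w : Finset κ) (j : κ) : ℝ := if j ∈ w then 1 else -1

variable [Fintype κ]

theorem sum_exp_sum_mul_memSign_le (a : κ → ℝ) :
    ∑ w, exp (∑ j, a j * memSign w j) ≤ 2 ^ Fintype.card κ * exp ((∑ j, a j ^ 2) / 2) := by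
  have hfactor : ∀ w : Finset κ, exp (∑ j, a j * memSign w j) =
      (∏ j ∈ w, exp (a j)) * ∏ j ∈ univ \ w, exp (-a j) := by
    intro w
    rw [exp_sum, ← prod_sdiff (subset_univ w), mul_comm]
    congr 1 <;> refine prod_congr rfl fun j hj => ?_
    · simp [memSign, hj]
    · simp [memSign, (mem_sdiff.1 hj).2]
  calc ∑ w, exp (∑ j, a j * memSign w j)
      = ∏ j, (exp (a j) + exp (-a j)) := by
        rw [prod_add, powerset_univ]
        exact sum_congr rfl fun w _ => hfactor w
    _ ≤ ∏ j, (2 * exp (a j ^ 2 / 2)) := by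
        refine prod_le_prod (fun j _ => by positivity) fun j _ => ?_
        have := cosh_le_exp_half_sq (a j)
        rw [cosh_eq] at this
        linarith
    _ = 2 ^ Fintype.card κ * exp ((∑ j, a j ^ 2) / 2) := by
        rw [prod_mul_distrib, ← exp_sum, ← sum_div]
        simp

theorem log_sum_exp_sum_mul_memSign_div_le (a : κ → ℝ) {D : ℝ} (hD : 0 < D) :
    log ((∑ w, exp (∑ j, a j * memSign w j)) / D) ≤
      log (2 ^ Fintype.card κ / D) + (∑ j, a j ^ 2) / 2 := by
  have : 0 < ∑ w : Finset κ, exp (∑ j, a j * memSign w j) :=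
    sum_pos (fun w _ => exp_pos _) univ_nonempty
  calc log ((∑ w, exp (∑ j, a j * memSign w j)) / D)
      ≤ log (2 ^ Fintype.card κ * exp ((∑ j, a j ^ 2) / 2) / D) := by
        gcongr
        exact sum_exp_sum_mul_memSign_le a
    _ = log (2 ^ Fintype.card κ / D) + (∑ j, a j ^ 2) / 2 := by
        rw [mul_div_right_comm, log_mul (by positivity) (exp_ne_zero _), log_exp]

theorem level_one_inequality {e : Finset κ → ℝ} (he0 : ∀ w, 0 ≤ e w) (he1 : ∀ w, e w ≤ 1) :
    ∑ j, (∑ w, e w * memSign w j) ^ 2 ≤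
      2 * (∑ w, e w) ^ 2 * log (2 ^ Fintype.card κ / ∑ w, e w) := by
  set D := ∑ w, e w with hD
  set d : κ → ℝ := fun j => ∑ w, e w * memSign w j with hd
  have hD0 : 0 ≤ D := sum_nonneg fun w _ => he0 w
  rcases hD0.eq_or_lt with hD0 | hDpos
  · have he : ∀ w, e w = 0 := fun w =>
      (sum_eq_zero_iff_of_nonneg fun w _ => he0 w).1 (hD.symm.trans hD0.symm) w (mem_univ w)
    simp [he, ← hD0]
  have hpair : ∑ w, e w * ∑ j, d j / D * memSign w j = (∑ j, d j ^ 2) / D := by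
    simp_rw [mul_sum]
    rw [sum_comm, sum_div]
    refine sum_congr rfl fun j _ => ?_
    calc ∑ w, e w * (d j / D * memSign w j) = d j / D * d j := by
          rw [hd, mul_sum]
          exact sum_congr rfl fun w _ => by ring
      _ = d j ^ 2 / D := by ring
  have hgibbs := sum_mul_le_mul_log_sum_exp_div he0 he1 fun w => ∑ j, d j / D * memSign w j
  rw [hpair, ← hD] at hgibbs
  have hbound : (∑ j, d j ^ 2) / D ≤
      D * (log (2 ^ Fintype.card κ / D) + (∑ j, d j ^ 2) / (2 * D ^ 2)) := by
    have hlog := log_sum_exp_sum_mul_memSign_div_le (fun j => d j / D) hDpos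
    simp_rw [div_pow] at hlog
    rw [← sum_div, div_div, mul_comm (D ^ 2)] at hlog
    exact hgibbs.trans (by gcongr)
  have hsq : ∑ j, d j ^ 2 ≤ D ^ 2 * log (2 ^ Fintype.card κ / D) + (∑ j, d j ^ 2) / 2 := by
    rw [div_le_iff₀ hDpos] at hbound
    refine hbound.trans_eq ?_
    field_simp
  linarith

end LevelOne

section Hellinger

variable {Λ : Type*} [Fintype Λ]

/-- The squared Hellinger distance of two finite measures with the given point masses; these are
not required to be normalized, and there is no factor `1 / 2`. -/
noncomputable def hellingerSq (p q : Λ → ℝ) : ℝ := ∑ t, (√(p t) - √(q t)) ^ 2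

theorem hellingerSq_comm (p q : Λ → ℝ) : hellingerSq p q = hellingerSq q p :=
  sum_congr rfl fun _ _ => sub_sq_comm _ _

theorem hellingerSq_le_two_mul_add (p q r : Λ → ℝ) :
    hellingerSq p r ≤ 2 * (hellingerSq p q + hellingerSq q r) := by
  rw [hellingerSq, hellingerSq, hellingerSq, ← sum_add_distrib, mul_sum]
  refine sum_le_sum fun t _ => ?_
  simpa using add_sq_le (a := √(p t) - √(q t)) (b := √(q t) - √(r t))

theorem sum_sub_le_hellingerSq {p q : Λ → ℝ} (hp : ∀ t, 0 ≤ p t) (hq : ∀ t, 0 ≤ q t)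
    (G : Finset Λ) :
    ∑ t ∈ G, (p t - q t) ≤ 6 * hellingerSq p q + (∑ t, p t + ∑ t, q t) / 12 := by
  have pointwise : ∀ t, p t - q t ≤ 6 * (√(p t) - √(q t)) ^ 2 + (p t + q t) / 12 := by
    intro t
    have := sq_sqrt (hp t)
    have := sq_sqrt (hq t)
    nlinarith [sq_nonneg (12 * (√(p t) - √(q t)) - (√(p t) + √(q t))),
      sq_nonneg (√(p t) - √(q t))]
  calc ∑ t ∈ G, (p t - q t)
      ≤ ∑ t ∈ G, (6 * (√(p t) - √(q t)) ^ 2 + (p t + q t) / 12) :=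
        sum_le_sum fun t _ => pointwise t
    _ ≤ ∑ t, (6 * (√(p t) - √(q t)) ^ 2 + (p t + q t) / 12) :=
        sum_le_univ_sum_of_nonneg fun t => by have := hp t; have := hq t; positivity
    _ = 6 * hellingerSq p q + (∑ t, p t + ∑ t, q t) / 12 := by
        rw [sum_add_distrib, ← mul_sum, ← sum_div, sum_add_distrib, hellingerSq]

theorem hellingerSq_eq_of_mul_eq_mul {p q r s : Λ → ℝ} (hp : ∀ t, 0 ≤ p t) (hq : ∀ t, 0 ≤ q t)
    (hr : ∀ t, 0 ≤ r t) (hs : ∀ t, 0 ≤ s t) (hmul : ∀ t, p t * q t = r t * s t)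
    (hsum : ∑ t, p t + ∑ t, q t = ∑ t, r t + ∑ t, s t) :
    hellingerSq p q = hellingerSq r s := by
  have expand : ∀ {f g : Λ → ℝ}, (∀ t, 0 ≤ f t) → (∀ t, 0 ≤ g t) →
      hellingerSq f g = ∑ t, f t + ∑ t, g t - 2 * ∑ t, √(f t * g t) := by
    intro f g hf hg
    rw [hellingerSq, ← sum_add_distrib, mul_sum, ← sum_sub_distrib]
    refine sum_congr rfl fun t _ => ?_
    rw [sub_sq, sq_sqrt (hf t), sq_sqrt (hg t), sqrt_mul (hf t)]
    ring
  rw [expand hp hq, expand hr hs, hsum]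
  simp_rw [hmul]

end Hellinger

section FiberCount

variable {α Λ : Type*} [Fintype α] [DecidableEq Λ]

/-- The number of points that `φ` maps to `t`: the point masses of the pushforward under `φ` of the
counting measure. -/
def fiberCount (φ : α → Λ) (t : Λ) : ℝ := ∑ a, if φ a = t then 1 else 0

theorem fiberCount_nonneg (φ : α → Λ) (t : Λ) : 0 ≤ fiberCount φ t :=
  sum_nonneg fun _ _ => by positivity

theorem sum_fiberCount (φ : α → Λ) (G : Finset Λ) :
    ∑ t ∈ G, fiberCount φ t = ∑ a, if φ a ∈ G then 1 else 0 := by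
  simp only [fiberCount]
  rw [sum_comm]
  simp only [sum_ite_eq]

theorem sum_univ_fiberCount [Fintype Λ] (φ : α → Λ) :
    ∑ t, fiberCount φ t = Fintype.card α := by
  simp [sum_fiberCount]

theorem sum_fiberCount_mul_log_le [Fintype Λ] (φ : α → Λ) :
    ∑ t, fiberCount φ t * log (Fintype.card α / fiberCount φ t) ≤
      Fintype.card α * log (Fintype.card Λ) := by
  rcases isEmpty_or_nonempty α with hα | hα
  · simp [fiberCount]
  have hcard : (0 : ℝ) < Fintype.card α := by exact_mod_cast Fintype.card_pos
  have h := sum_mul_log_div_le (fiberCount_nonneg φ) fun _ => hcard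
  rwa [sum_univ_fiberCount, sum_const, card_univ, nsmul_eq_mul, mul_div_cancel_right₀ _ hcard.ne']
    at h

end FiberCount

section Cube

variable {κ : Type*} [Fintype κ] [DecidableEq κ]

theorem two_mul_sum_eq_sum_insert_add_sum_erase (j : κ) (F : Finset κ → ℝ) :
    2 * ∑ w, F w = ∑ w, F (insert j w) + ∑ w : Finset κ, F (w.erase j) := by
  have hflip : Function.Involutive fun w : Finset κ => if j ∈ w then w.erase j else insert j w := by
    intro w
    by_cases hj : j ∈ w <;> simp [hj]
  rw [two_mul]
  nth_rewrite 2 [← Equiv.sum_comp hflip.toPerm F]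
  rw [← sum_add_distrib, ← sum_add_distrib]
  refine sum_congr rfl fun w _ => ?_
  by_cases hj : j ∈ w
  · simp [hj]
  · simp [hj, add_comm]

theorem sq_sqrt_sub_sqrt_mul_add_le {p q : ℝ} (hp : 0 ≤ p) (hq : 0 ≤ q) :
    (√p - √q) ^ 2 * (p + q) ≤ (p - q) ^ 2 := by
  have hp2 := sq_sqrt hp
  have hq2 := sq_sqrt hq
  calc (√p - √q) ^ 2 * (p + q) ≤ (√p - √q) ^ 2 * (√p + √q) ^ 2 := by
        gcongr
        nlinarith [sqrt_nonneg p, sqrt_nonneg q, mul_nonneg (sqrt_nonneg p) (sqrt_nonneg q)]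
    _ = (√p ^ 2 - √q ^ 2) ^ 2 := by ring
    _ = (p - q) ^ 2 := by rw [hp2, hq2]

theorem sum_sq_sqrt_insert_sub_sqrt_erase_le {e : Finset κ → ℝ} (he0 : ∀ w, 0 ≤ e w)
    (he1 : ∀ w, e w ≤ 1) :
    ∑ j, (√(∑ w, e (insert j w)) - √(∑ w : Finset κ, e (w.erase j))) ^ 2 ≤
      4 * ((∑ w, e w) * log (2 ^ Fintype.card κ / ∑ w, e w)) := by
  have hins : ∀ j, 0 ≤ ∑ w, e (insert j w) := fun j => sum_nonneg fun w _ => he0 _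
  have hera : ∀ j, 0 ≤ ∑ w : Finset κ, e (w.erase j) := fun j => sum_nonneg fun w _ => he0 _
  have hsplit := fun j => two_mul_sum_eq_sum_insert_add_sum_erase j e
  have hdiff : ∀ j, 2 * ∑ w, e w * memSign w j =
      ∑ w, e (insert j w) - ∑ w : Finset κ, e (w.erase j) := by
    intro j
    rw [two_mul_sum_eq_sum_insert_add_sum_erase j]
    simp [memSign, sub_eq_add_neg]
  have hD : 0 ≤ ∑ w, e w := sum_nonneg fun w _ => he0 w
  rcases hD.eq_or_lt with hD | hD
  · have hzero : ∀ j, ∑ w, e (insert j w) = 0 ∧ ∑ w : Finset κ, e (w.erase j) = 0 := fun j => by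
      constructor <;> linarith [hins j, hera j, hsplit j]
    simp [hzero, ← hD]
  refine le_of_mul_le_mul_right ?_ (mul_pos two_pos hD)
  calc (∑ j, (√(∑ w, e (insert j w)) - √(∑ w : Finset κ, e (w.erase j))) ^ 2) * (2 * ∑ w, e w)
      = ∑ j, (√(∑ w, e (insert j w)) - √(∑ w : Finset κ, e (w.erase j))) ^ 2 *
          (∑ w, e (insert j w) + ∑ w : Finset κ, e (w.erase j)) := by
        rw [sum_mul]
        exact sum_congr rfl fun j _ => by rw [hsplit]
    _ ≤ ∑ j, (2 * ∑ w, e w * memSign w j) ^ 2 := sum_le_sum fun j _ => by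
        rw [hdiff]
        exact sq_sqrt_sub_sqrt_mul_add_le (hins j) (hera j)
    _ = 4 * ∑ j, (∑ w, e w * memSign w j) ^ 2 := by
        rw [mul_sum]
        exact sum_congr rfl fun j _ => by ring
    _ ≤ 4 * (2 * (∑ w, e w) ^ 2 * log (2 ^ Fintype.card κ / ∑ w, e w)) := by
        gcongr
        exact level_one_inequality he0 he1
    _ = 4 * ((∑ w, e w) * log (2 ^ Fintype.card κ / ∑ w, e w)) * (2 * ∑ w, e w) := by ring

theorem sum_hellingerSq_insert_erase_le {Λ : Type*} [Fintype Λ] [DecidableEq Λ]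
    (φ : Finset κ → Λ) :
    ∑ j, hellingerSq (fiberCount fun w => φ (insert j w))
        (fiberCount fun w : Finset κ => φ (w.erase j)) ≤
      4 * (2 ^ Fintype.card κ * log (Fintype.card Λ)) := by
  calc ∑ j, hellingerSq (fiberCount fun w => φ (insert j w))
        (fiberCount fun w : Finset κ => φ (w.erase j))
      = ∑ t, ∑ j, (√(fiberCount (fun w => φ (insert j w)) t) -
          √(fiberCount (fun w : Finset κ => φ (w.erase j)) t)) ^ 2 := sum_comm
    _ ≤ ∑ t, 4 * (fiberCount φ t * log (2 ^ Fintype.card κ / fiberCount φ t)) :=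
        sum_le_sum fun t _ => sum_sq_sqrt_insert_sub_sqrt_erase_le
          (e := fun w => if φ w = t then 1 else 0)
          (fun w => by positivity) fun w => by split_ifs <;> norm_num
    _ ≤ 4 * (2 ^ Fintype.card κ * log (Fintype.card Λ)) := by
        rw [← mul_sum]
        gcongr
        simpa using sum_fiberCount_mul_log_le φ

end Cube

section Disjointness

variable {ι Λ : Type*}

/-- The fibres of `τ` are combinatorial rectangles, as are the sets of inputs on which a two-party
protocol has a given transcript. -/
def HasRectangularFibers {X Y : Type*} (τ : X → Y → Λ) : Prop :=
  ∀ x y x' y', τ x y = τ x' y' → τ x y' = τ x y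

variable [DecidableEq ι]

/-- The set `s` with the membership of `i` changed to `b`. -/
def updateMem (s : Finset ι) (i : ι) (b : Bool) : Finset ι := if b then insert i s else s.erase i

theorem mem_updateMem {s : Finset ι} {i j : ι} {b : Bool} :
    j ∈ updateMem s i b ↔ if j = i then b = true else j ∈ s := by
  cases b <;> by_cases h : j = i <;> simp [updateMem, h]

/-- The first set of the input of disjointness with parameters `q = (i, z, w)`: the sets `w ∩ z` and
`w \ z` are disjoint, and the element `i` is then put into or taken out of each of them. -/
def leftInput (q : ι × Finset ι × Finset ι) (a : Bool) : Finset ι :=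
  updateMem (q.2.2 ∩ q.2.1) q.1 a

/-- The second set of the input of disjointness with parameters `q = (i, z, w)`; see `leftInput`. -/
def rightInput (q : ι × Finset ι × Finset ι) (b : Bool) : Finset ι :=
  updateMem (q.2.2 \ q.2.1) q.1 b

theorem disjoint_leftInput_rightInput_iff (q : ι × Finset ι × Finset ι) (b : Bool) :
    Disjoint (leftInput q b) (rightInput q b) ↔ b = false := by
  simp only [disjoint_left, leftInput, rightInput, mem_updateMem, mem_inter, mem_sdiff]
  refine ⟨fun h => by_contra fun hb => by simpa [hb] using h (a := q.1), fun hb j => ?_⟩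
  grind

variable [Fintype ι] [DecidableEq Λ]

/-- The number of `w` for which `τ` has the value `t` at the input of disjointness with parameters
`(i, z, w)`, where `a` and `b` tell whether `i` belongs to the two sets. -/
def leafCount (τ : Finset ι → Finset ι → Λ) (z : Finset ι) (i : ι) (a b : Bool) : Λ → ℝ :=
  fiberCount fun w => τ (leftInput (i, z, w) a) (rightInput (i, z, w) b)

variable (τ : Finset ι → Finset ι → Λ) (z : Finset ι) (i : ι) (a b : Bool)

theorem leafCount_insert : leafCount τ (insert i z) i a b = leafCount τ z i a b := by
  unfold leafCount leftInput rightInput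
  congr! 3 with w <;> ext j <;> simp only [mem_updateMem] <;> grind

theorem leafCount_erase : leafCount τ (z.erase i) i a b = leafCount τ z i a b := by
  unfold leafCount leftInput rightInput
  congr! 3 with w <;> ext j <;> simp only [mem_updateMem] <;> grind

theorem sum_mul_sum_swap_sdiff (f f' g g' : Finset ι → ℝ) :
    (∑ w, f (w ∩ z) * g (w \ z)) * ∑ w, f' (w ∩ z) * g' (w \ z) =
      (∑ w, f (w ∩ z) * g' (w \ z)) * ∑ w, f' (w ∩ z) * g (w \ z) := by
  let swap (p : Finset ι × Finset ι) : Finset ι × Finset ι :=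
    (p.1 ∩ z ∪ p.2 \ z, p.2 ∩ z ∪ p.1 \ z)
  have inter (u v : Finset ι) : (u ∩ z ∪ v \ z) ∩ z = u ∩ z := by grind
  have sdiff (u v : Finset ι) : (u ∩ z ∪ v \ z) \ z = v \ z := by grind
  have glue (w : Finset ι) : w ∩ z ∪ w \ z = w := by grind
  have hswap : Function.Involutive swap := fun p => by
    simp only [swap, inter, sdiff, glue]
  simp_rw [sum_mul_sum, ← Fintype.sum_prod_type']
  rw [← Equiv.sum_comp hswap.toPerm]
  refine sum_congr rfl fun p _ => ?_
  simp only [Function.Involutive.coe_toPerm, swap, inter, sdiff]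
  ring

variable {τ} in
theorem leafCount_mul_leafCount (hτ : HasRectangularFibers τ) (t : Λ) :
    leafCount τ z i true true t * leafCount τ z i false false t =
      leafCount τ z i true false t * leafCount τ z i false true t := by
  classical
  let row (a : Bool) (u : Finset ι) : ℝ := if ∃ y, τ (updateMem u i a) y = t then 1 else 0
  let col (b : Bool) (v : Finset ι) : ℝ := if ∃ x, τ x (updateMem v i b) = t then 1 else 0
  have hfactor : ∀ a b, leafCount τ z i a b t = ∑ w, row a (w ∩ z) * col b (w \ z) := by
    intro a b
    simp only [leafCount, fiberCount, row, col, leftInput, rightInput]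
    refine sum_congr rfl fun w _ => ?_
    rw [ite_zero_mul_ite_zero, mul_one]
    refine if_congr ⟨fun h => ⟨⟨_, h⟩, ⟨_, h⟩⟩, ?_⟩ rfl rfl
    rintro ⟨⟨y, hy⟩, ⟨x, hx⟩⟩
    rw [hτ _ _ _ _ (hy.trans hx.symm), hy]
  simp_rw [hfactor]
  exact sum_mul_sum_swap_sdiff z _ _ _ _

variable [Fintype Λ]

theorem sum_leafCount : ∑ t, leafCount τ z i a b t = 2 ^ Fintype.card ι := by
  simp [leafCount, sum_univ_fiberCount]

variable {τ} in
theorem sum_leafCount_sub_le (hτ : HasRectangularFibers τ) (G : Finset Λ) :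
    ∑ t ∈ G, (leafCount τ z i true true t - leafCount τ z i false false t) ≤
      12 * (hellingerSq (leafCount τ z i true false) (leafCount τ z i false false) +
        hellingerSq (leafCount τ z i false true) (leafCount τ z i false false)) +
      2 ^ Fintype.card ι / 6 := by
  have nonneg : ∀ a b t, 0 ≤ leafCount τ z i a b t := fun _ _ _ => fiberCount_nonneg _ _
  have cut_and_paste :
      hellingerSq (leafCount τ z i true true) (leafCount τ z i false false) =
        hellingerSq (leafCount τ z i true false) (leafCount τ z i false true) :=
    hellingerSq_eq_of_mul_eq_mul (nonneg _ _) (nonneg _ _) (nonneg _ _) (nonneg _ _)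
      (leafCount_mul_leafCount z i hτ) (by simp only [sum_leafCount])
  have triangle := hellingerSq_le_two_mul_add (leafCount τ z i true false)
    (leafCount τ z i false false) (leafCount τ z i false true)
  rw [hellingerSq_comm (leafCount τ z i false false)] at triangle
  have hsub := sum_sub_le_hellingerSq (nonneg true true) (nonneg false false) G
  rw [cut_and_paste, sum_leafCount, sum_leafCount] at hsub
  linarith

theorem sum_hellingerSq_leafCount_le :
    ∑ i, (if i ∈ z then hellingerSq (leafCount τ z i true false) (leafCount τ z i false false)
        else hellingerSq (leafCount τ z i false true) (leafCount τ z i false false)) ≤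
      4 * (2 ^ Fintype.card ι * log (Fintype.card Λ)) := by
  refine le_of_eq_of_le (sum_congr rfl fun i _ => ?_)
    (sum_hellingerSq_insert_erase_le fun w => τ (w ∩ z) (w \ z))
  unfold leafCount leftInput rightInput
  split_ifs <;> congr! 4 with w <;> ext j <;> simp only [mem_updateMem] <;> grind

variable {τ} in
theorem sum_mem_intersecting_sub_mem_disjoint_le (hτ : HasRectangularFibers τ) (G : Finset Λ) :
    ∑ q, ((if τ (leftInput q true) (rightInput q true) ∈ G then (1 : ℝ) else 0) -
        if τ (leftInput q false) (rightInput q false) ∈ G then 1 else 0) ≤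
      (2 ^ Fintype.card ι) ^ 2 * (Fintype.card ι / 6 + 96 * log (Fintype.card Λ)) := by
  set N : ℝ := 2 ^ Fintype.card ι with hN
  let H₁ (i : ι) (z : Finset ι) : ℝ :=
    hellingerSq (leafCount τ z i true false) (leafCount τ z i false false)
  let H₂ (i : ι) (z : Finset ι) : ℝ :=
    hellingerSq (leafCount τ z i false true) (leafCount τ z i false false)
  -- Neither `H₁ i z` nor `H₂ i z` depends on the membership of `i` in `z`.
  have hselect : ∀ i, ∑ z, (12 * (H₁ i z + H₂ i z) + N / 6) =
      24 * ∑ z, (if i ∈ z then H₁ i z else H₂ i z) + N * (N / 6) := fun i => by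
    have h := two_mul_sum_eq_sum_insert_add_sum_erase i fun z => if i ∈ z then H₁ i z else H₂ i z
    simp only [H₁, H₂, mem_insert_self, notMem_erase, if_true, if_false, leafCount_insert,
      leafCount_erase] at h
    rw [sum_add_distrib, ← mul_sum, sum_add_distrib, ← h]
    norm_num [hN]
    ring
  calc _ = ∑ i, ∑ z, ∑ t ∈ G, (leafCount τ z i true true t - leafCount τ z i false false t) := by
        simp_rw [Fintype.sum_prod_type, sum_sub_distrib, leafCount, sum_fiberCount]
    _ ≤ ∑ i, ∑ z, (12 * (H₁ i z + H₂ i z) + N / 6) :=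
        sum_le_sum fun i _ => sum_le_sum fun z _ => sum_leafCount_sub_le z i hτ G
    _ = 24 * ∑ z, ∑ i, (if i ∈ z then H₁ i z else H₂ i z) + Fintype.card ι * (N * (N / 6)) := by
        simp_rw [hselect]
        rw [sum_add_distrib, ← mul_sum, sum_comm, sum_const, card_univ, nsmul_eq_mul]
    _ ≤ 24 * ∑ _z : Finset ι, 4 * (N * log (Fintype.card Λ)) +
          Fintype.card ι * (N * (N / 6)) := by
        gcongr with z
        exact sum_hellingerSq_leafCount_le τ z
    _ = N ^ 2 * (Fintype.card ι / 6 + 96 * log (Fintype.card Λ)) := by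
        rw [sum_const, card_univ, Fintype.card_finset, nsmul_eq_mul, hN]
        push_cast
        ring

end Disjointness

section Protocol

variable {ι : Type*} {n : ℕ} {X : Type}

namespace Protocol

/-- The messages sent on the inputs `x`, then the answer, then `false` forever. -/
def transcript : Protocol n X Bool → (Fin n → X) → ℕ → Bool
  | declare i f, x, 0 => f (x i)
  | declare _ _, _, _ + 1 => false
  | speak i f _, x, 0 => f (x i)
  | speak i f next, x, t + 1 => (next (f (x i))).transcript x t

theorem transcript_eq_false_of_bits_lt (p : Protocol n X Bool) (x : Fin n → X) {t : ℕ}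
    (ht : p.bits x < t) : p.transcript x t = false := by
  induction p generalizing t with
  | declare i f => cases t <;> simp_all [transcript, bits]
  | speak i f next ih =>
    cases t with
    | zero => simp at ht
    | succ t => exact ih _ (Nat.lt_of_succ_lt_succ ht)

theorem answer_eq_of_transcript_eq (p : Protocol n X Bool) {x y : Fin n → X}
    (h : p.transcript x = p.transcript y) : p.answer x = p.answer y := by
  induction p with
  | declare i f => exact congrFun h 0
  | speak i f next ih =>
    have hbit : f (x i) = f (y i) := congrFun h 0
    have htail := funext fun t => congrFun h (t + 1)
    simp only [transcript, answer, hbit] at htail ⊢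
    exact ih _ htail

theorem transcript_mix (p : Protocol n X Bool) {x y z : Fin n → X}
    (hz : ∀ i, z i = x i ∨ z i = y i) (h : p.transcript x = p.transcript y) :
    p.transcript z = p.transcript x := by
  induction p with
  | declare i f =>
    funext t
    cases t with
    | zero => rcases hz i with e | e <;> simp only [transcript, e]; exact (congrFun h 0).symm
    | succ t => rfl
  | speak i f next ih =>
    have hxy : f (x i) = f (y i) := congrFun h 0
    have hzx : f (z i) = f (x i) := by rcases hz i with e | e <;> rw [e]; exact hxy.symm
    have htail := funext fun t => congrFun h (t + 1)
    simp only [transcript, ← hxy] at htail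
    funext t
    cases t with
    | zero => exact hzx
    | succ t => simpa only [transcript, hzx] using congrFun (ih _ htail) t

theorem transcript_eq_of_forall_fin (p : Protocol n X Bool) {B : ℕ} {x y : Fin n → X}
    (hx : p.bits x ≤ B) (hy : p.bits y ≤ B)
    (h : ∀ t : Fin (B + 1), p.transcript x t = p.transcript y t) :
    p.transcript x = p.transcript y := by
  funext t
  rcases Nat.lt_or_ge t (B + 1) with ht | ht
  · exact h ⟨t, ht⟩
  · rw [transcript_eq_false_of_bits_lt, transcript_eq_false_of_bits_lt] <;> omega

variable [Fintype ι] [DecidableEq ι]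

theorem sum_answer_intersecting_sub_answer_disjoint_le (p : Protocol n X Bool)
    {inp : Finset ι → Finset ι → Fin n → X}
    (hinp : ∀ i, (∀ x y y', inp x y i = inp x y' i) ∨ ∀ x x' y, inp x y i = inp x' y i)
    {B : ℕ} (hB : ∀ x y, p.bits (inp x y) ≤ B) :
    ∑ q, ((if p.answer (inp (leftInput q true) (rightInput q true)) = true then (1 : ℝ) else 0) -
        if p.answer (inp (leftInput q false) (rightInput q false)) = true then 1 else 0) ≤
      (2 ^ Fintype.card ι) ^ 2 * (Fintype.card ι / 6 + 96 * ((B + 1) * log 2)) := by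
  classical
  let τ (x y : Finset ι) (t : Fin (B + 1)) : Bool := p.transcript (inp x y) t
  have transcript_eq : ∀ {x y x' y'}, τ x y = τ x' y' →
      p.transcript (inp x y) = p.transcript (inp x' y') := fun h =>
    p.transcript_eq_of_forall_fin (hB _ _) (hB _ _) (congrFun h)
  have hτ : HasRectangularFibers τ := fun x y x' y' h => by
    have hmix := p.transcript_mix (z := inp x y')
      (fun i => (hinp i).imp (fun hi => hi _ _ _) fun hi => hi _ _ _) (transcript_eq h)
    exact funext fun t => congrFun hmix t
  let G : Finset (Fin (B + 1) → Bool) := {t | ∃ x y, τ x y = t ∧ p.answer (inp x y) = true}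
  have hG : ∀ x y, τ x y ∈ G ↔ p.answer (inp x y) = true := by
    intro x y
    simp only [G, mem_filter, mem_univ, true_and]
    refine ⟨?_, fun h => ⟨x, y, rfl, h⟩⟩
    rintro ⟨x', y', hxy, hans⟩
    rwa [← p.answer_eq_of_transcript_eq (transcript_eq hxy)]
  have hlog : log (Fintype.card (Fin (B + 1) → Bool)) = (B + 1) * log 2 := by simp
  simpa only [hG, hlog] using sum_mem_intersecting_sub_mem_disjoint_le hτ G

end Protocol

theorem sum_measureReal_sub_le_of_forall {Ω J : Type*} [MeasurableSpace Ω] [Fintype J]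
    (μ : Measure Ω) [IsProbabilityMeasure μ] {s t : J → Set Ω} (hs : ∀ j, MeasurableSet (s j))
    (ht : ∀ j, MeasurableSet (t j)) {c : ℝ}
    (h : ∀ ω, ∑ j, ((s j).indicator 1 ω - (t j).indicator 1 ω) ≤ c) :
    ∑ j, (μ.real (s j) - μ.real (t j)) ≤ c := by
  have integrable {u : Set Ω} (hu : MeasurableSet u) : Integrable (u.indicator (1 : Ω → ℝ)) μ :=
    (integrable_const 1).indicator hu
  have integrable_sub : ∀ j, Integrable
      (fun ω => (s j).indicator 1 ω - (t j).indicator (1 : Ω → ℝ) ω) μ := fun j =>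
    (integrable (hs j)).sub (integrable (ht j))
  calc ∑ j, (μ.real (s j) - μ.real (t j))
      = ∫ ω, ∑ j, ((s j).indicator 1 ω - (t j).indicator (1 : Ω → ℝ) ω) ∂μ := by
        rw [integral_finsetSum _ fun j _ => integrable_sub j]
        refine sum_congr rfl fun j _ => ?_
        rw [integral_sub (integrable (hs j)) (integrable (ht j)), integral_indicator_one (hs j),
          integral_indicator_one (ht j)]
    _ ≤ ∫ _, c ∂μ := integral_mono (integrable_finsetSum _ fun j _ => integrable_sub j)
        (integrable_const c) h
    _ = c := by simp

instance (n : ℕ) : IsProbabilityMeasure (coinMeasure n) := by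
  unfold coinMeasure
  infer_instance

/-- A reduction of two-party set disjointness on subsets of `ι` to the decision problem `Right` on
the inputs with `x i ∈ D i`. The input of each player encodes at most one of the two sets, so that
the players can translate without communicating. -/
structure DisjointnessReduction (ι : Type*) {n : ℕ} {X : Type} (D : Fin n → Set X)
    (Right : (Fin n → X) → Bool → Prop) where
  inp : Finset ι → Finset ι → Fin n → X
  inp_mem : ∀ x y i, inp x y i ∈ D i
  inp_left_or_right : ∀ i,
    (∀ x y y', inp x y i = inp x y' i) ∨ ∀ x x' y, inp x y i = inp x' y i
  right_iff : ∀ x y b, Right (inp x y) b ↔ (b = true ↔ ¬ Disjoint x y)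

namespace DisjointnessReduction

variable {D : Fin n → Set X} {Right : (Fin n → X) → Bool → Prop}

theorem two_thirds_le_measureReal (R : DisjointnessReduction ι D Right) {Γ : RandProtocol n X Bool}
    (hΓ : Γ.Correct D Right) (x y : Finset ι) :
    2 / 3 ≤ (coinMeasure n).real {ω | (Γ.det ω).answer (R.inp x y) = true ↔ ¬ Disjoint x y} := by
  have h := ENNReal.toReal_mono (measure_ne_top _ _) (hΓ _ (R.inp_mem x y))
  simpa only [Measure.real, R.right_iff, ENNReal.toReal_div, ENNReal.toReal_ofNat] using h

theorem one_third_le_measureReal_sub (R : DisjointnessReduction ι D Right)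
    {Γ : RandProtocol n X Bool} (hΓ : Γ.Correct D Right) {x y x' y' : Finset ι}
    (h : ¬ Disjoint x y) (h' : Disjoint x' y') :
    1 / 3 ≤ (coinMeasure n).real {ω | (Γ.det ω).answer (R.inp x y) = true} -
      (coinMeasure n).real {ω | (Γ.det ω).answer (R.inp x' y') = true} := by
  have hinter := R.two_thirds_le_measureReal hΓ x y
  have hdisj := R.two_thirds_le_measureReal hΓ x' y'
  simp only [h, h', not_true, not_false_iff, iff_true, iff_false] at hinter hdisj
  rw [← Set.compl_ofPred, probReal_compl_eq_one_sub (Γ.measurable_answer _ _)] at hdisj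
  linarith

variable [Fintype ι]

theorem card_le_of_cost_le (R : DisjointnessReduction ι D Right) {Γ : RandProtocol n X Bool}
    (hΓ : Γ.Correct D Right) {B : ℕ} (hB : Γ.cost D ≤ B) :
    (Fintype.card ι : ℝ) ≤ 400 * (B + 1) := by
  classical
  have hbits : ∀ ω x y, (Γ.det ω).bits (R.inp x y) ≤ B := fun ω x y => by
    exact_mod_cast (le_iSup₂_of_le (R.inp x y) (R.inp_mem x y) (le_iSup_of_le ω le_rfl)).trans hB
  set N : ℝ := 2 ^ Fintype.card ι with hN
  have upper := sum_measureReal_sub_le_of_forall (coinMeasure n)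
    (fun q => Γ.measurable_answer (R.inp (leftInput q true) (rightInput q true)) true)
    (fun q => Γ.measurable_answer (R.inp (leftInput q false) (rightInput q false)) true)
    (c := N ^ 2 * (Fintype.card ι / 6 + 96 * ((B + 1) * log 2))) fun ω => by
      simpa only [Set.indicator_apply, Set.mem_ofPred_eq, Pi.one_apply] using
        (Γ.det ω).sum_answer_intersecting_sub_answer_disjoint_le R.inp_left_or_right (hbits ω)
  have lower := sum_le_sum fun (q : ι × Finset ι × Finset ι) (_ : q ∈ univ) =>
    R.one_third_le_measureReal_sub hΓ (x := leftInput q true) (y := rightInput q true)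
      (x' := leftInput q false) (y' := rightInput q false)
      (by simp [disjoint_leftInput_rightInput_iff]) (by simp [disjoint_leftInput_rightInput_iff])
  have hcount : ∑ _q : ι × Finset ι × Finset ι, (1 / 3 : ℝ) = N ^ 2 * (Fintype.card ι / 3) := by
    simp only [sum_const, card_univ, Fintype.card_prod, Fintype.card_finset, nsmul_eq_mul, hN]
    push_cast
    ring
  have hcard : (Fintype.card ι : ℝ) / 3 ≤ Fintype.card ι / 6 + 96 * ((B + 1) * log 2) :=
    le_of_mul_le_mul_left (hcount.symm.trans_le (lower.trans upper)) (by positivity)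
  have := mul_le_mul_of_nonneg_left log_two_lt_d9.le (show (0 : ℝ) ≤ B + 1 by positivity)
  linarith

theorem le_randComplexity (R : DisjointnessReduction ι D Right) (hι : 400 < Fintype.card ι) :
    ((1 / 800 : ℝ≥0) : ℝ≥0∞) * Fintype.card ι ≤ (randComplexity D Right : ℝ≥0∞) := by
  rcases eq_or_ne (randComplexity D Right) ⊤ with htop | htop
  · simp [htop]
  obtain ⟨B, hB⟩ := ENat.ne_top_iff_exists.1 htop
  have hlt : randComplexity D Right < (B : ℕ∞) + 1 :=
    (ENat.lt_add_one_iff (ENat.natCast_ne_top B)).2 hB.ge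
  obtain ⟨Γ, hΓ, hcost⟩ : ∃ Γ : RandProtocol n X Bool, Γ.Correct D Right ∧ Γ.cost D < B + 1 := by
    simpa only [randComplexity, iInf_lt_iff, exists_prop] using hlt
  have hcard : (Fintype.card ι : ℝ) ≤ 400 * (B + 1) :=
    R.card_le_of_cost_le hΓ ((ENat.lt_add_one_iff (ENat.natCast_ne_top B)).1 hcost)
  have hcard' : Fintype.card ι ≤ 800 * B := by
    have : Fintype.card ι ≤ 400 * (B + 1) := by exact_mod_cast hcard
    omega
  have hle : (1 / 800 : ℝ≥0) * Fintype.card ι ≤ B := by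
    rw [one_div, inv_mul_le_iff₀ (by norm_num)]
    exact_mod_cast hcard'
  rw [← hB, ENat.toENNReal_coe]
  exact_mod_cast ENNReal.coe_le_coe.2 hle

end DisjointnessReduction

end Protocol

section CappedVal

variable {α : Type*} [DecidableEq α]

/-- Twice the size of the bundle, capped at `2 * k`, with a loss of `1` for the bundles of size `k`
that are not in the family `F` of favoured bundles. -/
def cappedVal (k : ℕ) (F : Finset (Finset α)) (S : Finset α) : ℕ :=
  if #S < k then 2 * #S else if #S = k ∧ S ∉ F then 2 * k - 1 else 2 * k

variable {k : ℕ} {F : Finset (Finset α)} {S T : Finset α}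

theorem cappedVal_le : cappedVal k F S ≤ 2 * k := by
  unfold cappedVal
  split_ifs <;> omega

theorem cappedVal_mono (h : S ⊆ T) : cappedVal k F S ≤ cappedVal k F T := by
  rcases h.eq_or_ssubset with rfl | hlt
  · rfl
  · have := card_lt_card hlt
    unfold cappedVal
    split_ifs <;> omega

theorem cappedVal_insert_add_le (h : S ⊆ T) (g : α) :
    cappedVal k F (insert g T) + cappedVal k F S ≤
      cappedVal k F (insert g S) + cappedVal k F T := by
  by_cases hgT : g ∈ T
  · rw [insert_eq_of_mem hgT, add_comm]
    gcongr
    exact cappedVal_mono (subset_insert g S)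
  rcases h.eq_or_ssubset with rfl | hlt
  · rfl
  have := card_lt_card hlt
  have := card_insert_of_notMem hgT
  have := card_insert_of_notMem fun hgS => hgT (h hgS)
  unfold cappedVal
  split_ifs <;> omega

theorem le_cappedVal_iff (hk : 0 < k) : 2 * k ≤ cappedVal k F S ↔ k < #S ∨ #S = k ∧ S ∈ F := by
  unfold cappedVal
  split_ifs <;> grind

theorem eq_sdiff_of_disjoint_of_le_card {P : Finset α} (hP : #P = 2 * k) (hS : S ⊆ P) (hT : T ⊆ P)
    (hST : Disjoint S T) (hkS : k ≤ #S) (hkT : k ≤ #T) : T = P \ S := by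
  refine eq_of_subset_of_card_le (subset_sdiff.2 ⟨hT, hST.symm⟩) ?_
  rw [card_sdiff_of_subset hS]
  omega

end CappedVal

section HardValuations

variable {m k : ℕ}

/-- The valuation that is `V` on the bundles with an item outside of `P`, and `cappedVal k F` on the
other bundles. -/
def hardValuation (P : Finset (Fin m)) (k : ℕ) (F : Finset (Finset (Fin m))) (V : ℝ)
    (hP : P ≠ univ) (hV : 0 < V) (hkV : 2 * k ≤ V) : Valuation m where
  val S := if S ⊆ P then (cappedVal k F S : ℝ) else V
  nonneg S := by split_ifs <;> positivity
  mono S T h := by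
    split_ifs with hS hT hT
    · exact_mod_cast cappedVal_mono h
    · exact (Nat.cast_le.2 cappedVal_le).trans (by exact_mod_cast hkV)
    · exact absurd (h.trans hT) hS
    · exact le_rfl
  normalized := by simp +contextual [cappedVal]
  total_pos := by rwa [if_neg fun h => hP (univ_subset_iff.1 h)]

section

variable {P : Finset (Fin m)} {F : Finset (Finset (Fin m))} {V : ℝ} (hP : P ≠ univ) (hV : 0 < V)
  (hkV : 2 * k ≤ V)

theorem hardValuation_univ : (hardValuation P k F V hP hV hkV).val univ = V :=
  if_neg fun h => hP (univ_subset_iff.1 h)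

theorem hardValuation_submodular : (hardValuation P k F V hP hV hkV).Submodular := by
  intro S T g h
  have hmono := (hardValuation P k F V hP hV hkV).mono _ _ (subset_insert g S)
  simp only [hardValuation, insert_subset_iff] at hmono ⊢
  by_cases hT : T ⊆ P
  · have hS := h.trans hT
    by_cases hg : g ∈ P
    · simp only [hg, hT, hS, and_self, if_true, sub_le_sub_iff]
      exact_mod_cast cappedVal_insert_add_le h g
    · simp only [hg, hT, hS, false_and, if_false, if_true]
      gcongr
      exact cappedVal_mono h
  · simpa only [hT, and_false, if_false, sub_self, sub_nonneg] using hmono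

theorem le_hardValuation_iff (hk : 0 < k) {S : Finset (Fin m)} :
    2 * k ≤ (hardValuation P k F V hP hV hkV).val S ↔ (S ⊆ P → k < #S ∨ #S = k ∧ S ∈ F) := by
  simp only [hardValuation]
  split_ifs with hS
  · rw [← le_cappedVal_iff hk]
    simp only [hS, true_imp_iff]
    exact_mod_cast Iff.rfl
  · simp [hS, hkV]

end

/-- The valuation that is `V` on the bundles with the item `g`, and `0` otherwise. -/
def singleItemValuation (g : Fin m) (V : ℝ) (hV : 0 < V) : Valuation m where
  val S := if g ∈ S then V else 0
  nonneg S := by split_ifs <;> linarith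
  mono S T h := by
    split_ifs with hS hT
    · exact le_rfl
    · exact absurd (h hS) hT
    · exact hV.le
    · exact le_rfl
  normalized := by simp
  total_pos := by simpa using hV

section

variable (g : Fin m) {V : ℝ} (hV : 0 < V)

theorem singleItemValuation_univ : (singleItemValuation g V hV).val univ = V :=
  if_pos (mem_univ g)

theorem singleItemValuation_submodular : (singleItemValuation g V hV).Submodular := by
  intro S T h hST
  have : g ∈ S → g ∈ T := @hST g
  simp only [singleItemValuation, mem_insert]
  split_ifs <;> first | linarith | tauto

theorem mem_of_singleItemValuation_pos {S : Finset (Fin m)}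
    (hS : 0 < (singleItemValuation g V hV).val S) : g ∈ S := by
  by_contra hg
  simp [singleItemValuation, hg] at hS

end

/-- A finite set that contains all values of `hardValuation` and of `singleItemValuation`. -/
noncomputable def hardValues (k : ℕ) (V : ℝ) : Finset ℝ :=
  insert V ((insert (2 * k - 1) ((range (k + 1)).image (2 * ·))).image Nat.cast)

theorem card_hardValues_le (k : ℕ) (V : ℝ) : #(hardValues k V) ≤ k + 3 := by
  have hrange : #((range (k + 1)).image (2 * ·)) ≤ k + 1 := card_image_le.trans (card_range _).le
  calc #(hardValues k V)
      ≤ #((insert (2 * k - 1) ((range (k + 1)).image (2 * ·))).image (Nat.cast : ℕ → ℝ)) + 1 :=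
        card_insert_le _ _
    _ ≤ #(insert (2 * k - 1) ((range (k + 1)).image (2 * ·))) + 1 := by
        gcongr
        exact card_image_le
    _ ≤ k + 3 := by
        have := card_insert_le (2 * k - 1) ((range (k + 1)).image (2 * ·))
        omega

theorem hardValuation_mem_hardValues {P : Finset (Fin m)} {F : Finset (Finset (Fin m))} {V : ℝ}
    (hP : P ≠ univ) (hV : 0 < V) (hkV : 2 * k ≤ V) (S : Finset (Fin m)) :
    (hardValuation P k F V hP hV hkV).val S ∈ hardValues k V := by
  simp only [hardValuation, hardValues]
  split_ifs
  · refine mem_insert_of_mem (mem_image_of_mem _ ?_)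
    simp only [cappedVal, mem_insert, mem_image, mem_range]
    split_ifs <;> grind
  · exact mem_insert_self _ _

theorem singleItemValuation_mem_hardValues (k : ℕ) (g : Fin m) {V : ℝ} (hV : 0 < V)
    (S : Finset (Fin m)) : (singleItemValuation g V hV).val S ∈ hardValues k V := by
  simp only [singleItemValuation, hardValues]
  split_ifs <;> simp

end HardValuations

section HardInstance

theorem mem_bundle_iff {n m : ℕ} {A : Allocation n m} {i : Fin n} {g : Fin m} :
    g ∈ A.bundle i ↔ A g = i :=
  mem_filter_univ g

/-- Hard instances of fair division for `n` players and `m` items: the first two players compete for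
the `2 * k` contested items, every other player wants exactly one of the remaining items, which is
reserved for that player, and all players value the set of all items at `topValue`. -/
structure HardInstance (n m k : ℕ) where
  two_lt : 2 < n
  k_pos : 0 < k
  contested : Finset (Fin m)
  card_contested : #contested = 2 * k
  reserved : Fin n → Fin m
  reserved_bijOn : Set.BijOn reserved {i | 2 ≤ (i : ℕ)} (contestedᶜ : Finset (Fin m))
  topValue : ℝ
  le_topValue : 2 * k ≤ topValue

namespace HardInstance

variable {n m k : ℕ} (I : HardInstance n m k)

/-- The bundles of half of the contested items, which index the disjointness problem. -/
abbrev Half : Type := {S // S ∈ I.contested.powersetCard k}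

theorem card_half : Fintype.card I.Half = (2 * k).choose k := by
  rw [Fintype.card_coe, card_powersetCard, card_contested]

/-- The first of the two competing players. -/
def left : Fin n := ⟨0, Nat.zero_lt_of_lt I.two_lt⟩

/-- The second of the two competing players. -/
def right : Fin n := ⟨1, Nat.lt_of_succ_lt I.two_lt⟩

theorem left_ne_right : I.left ≠ I.right := by simp [left, right]

theorem forall_player_iff {p : Fin n → Prop} :
    (∀ i, p i) ↔ p I.left ∧ p I.right ∧ ∀ i : Fin n, 2 ≤ (i : ℕ) → p i := by
  refine ⟨fun h => ⟨h _, h _, fun i _ => h i⟩, fun ⟨hleft, hright, hpublic⟩ i => ?_⟩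
  obtain rfl | rfl | hi : i = I.left ∨ i = I.right ∨ 2 ≤ (i : ℕ) := by
    simp only [left, right, Fin.ext_iff]
    omega
  exacts [hleft, hright, hpublic i hi]

theorem reserved_notMem_contested {i : Fin n} (hi : 2 ≤ (i : ℕ)) : I.reserved i ∉ I.contested := by
  simpa using I.reserved_bijOn.mapsTo hi

theorem contested_ne_univ : I.contested ≠ univ := fun h =>
  I.reserved_notMem_contested (i := ⟨2, I.two_lt⟩) le_rfl (h ▸ mem_univ _)

theorem topValue_pos : 0 < I.topValue := by
  have := I.k_pos
  exact lt_of_lt_of_le (by positivity) I.le_topValue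

/-- The valuation of a competing player who favours the halves in `F`. -/
def favouring (F : Finset (Finset (Fin m))) : Valuation m :=
  hardValuation I.contested k F I.topValue I.contested_ne_univ I.topValue_pos I.le_topValue

/-- The valuation of a non-competing player. -/
def publicValuation (i : Fin n) : Valuation m :=
  singleItemValuation (I.reserved i) I.topValue I.topValue_pos

/-- The valuations for the instance `(x, y)` of disjointness: the first player favours the halves in
`x`, and the second player the complements of the halves in `y`. -/
def profile (x y : Finset I.Half) (i : Fin n) : Valuation m :=
  if i = I.left then I.favouring (x.image Subtype.val)
  else if i = I.right then I.favouring (y.image fun S : I.Half => I.contested \ S.1)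
  else I.publicValuation i

variable (x y : Finset I.Half)

theorem profile_left : I.profile x y I.left = I.favouring (x.image Subtype.val) :=
  if_pos rfl

theorem profile_right :
    I.profile x y I.right = I.favouring (y.image fun S : I.Half => I.contested \ S.1) := by
  rw [profile, if_neg I.left_ne_right.symm, if_pos rfl]

theorem profile_of_two_le {i : Fin n} (hi : 2 ≤ (i : ℕ)) :
    I.profile x y i = I.publicValuation i := by
  have hleft : i ≠ I.left := by rintro rfl; simp [left] at hi
  have hright : i ≠ I.right := by rintro rfl; simp [right] at hi
  rw [profile, if_neg hleft, if_neg hright]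

theorem profile_univ (i : Fin n) : (I.profile x y i).val univ = I.topValue := by
  unfold profile
  split_ifs
  · exact hardValuation_univ ..
  · exact hardValuation_univ ..
  · exact singleItemValuation_univ ..

theorem profile_submodular (i : Fin n) : (I.profile x y i).Submodular := by
  unfold profile
  split_ifs
  · exact hardValuation_submodular _ _ _
  · exact hardValuation_submodular _ _ _
  · exact singleItemValuation_submodular _ _

theorem profile_mem_hardValues (i : Fin n) (S : Finset (Fin m)) :
    (I.profile x y i).val S ∈ hardValues k I.topValue := by
  unfold profile
  split_ifs
  · exact hardValuation_mem_hardValues ..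
  · exact hardValuation_mem_hardValues ..
  · exact singleItemValuation_mem_hardValues ..

theorem le_publicValuation_iff {i : Fin n} {S : Finset (Fin m)} :
    2 * k ≤ (I.publicValuation i).val S ↔ I.reserved i ∈ S := by
  have := I.k_pos
  refine ⟨fun h => mem_of_singleItemValuation_pos _ I.topValue_pos
    (lt_of_lt_of_le (by positivity) h), fun h => ?_⟩
  simpa only [publicValuation, singleItemValuation, if_pos h] using I.le_topValue

/-- A competing player who favours the halves in `F` is satisfied with the bundle `S`. -/
def Accepts (F : Finset (Finset (Fin m))) (S : Finset (Fin m)) : Prop :=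
  S ⊆ I.contested → k < #S ∨ #S = k ∧ S ∈ F

variable {x y} {c : ℝ}

theorem isProp_profile_iff (hc : c * (I.topValue / n) = 2 * k) (A : Allocation n m) :
    IsProp c (I.profile x y) A ↔
      I.Accepts (x.image Subtype.val) (A.bundle I.left) ∧
      I.Accepts (y.image fun S : I.Half => I.contested \ S.1) (A.bundle I.right) ∧
      ∀ i : Fin n, 2 ≤ (i : ℕ) → I.reserved i ∈ A.bundle i := by
  simp only [IsProp, profile_univ, hc]
  rw [I.forall_player_iff, profile_left, profile_right]
  refine and_congr (le_hardValuation_iff _ _ _ I.k_pos) <|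
    and_congr (le_hardValuation_iff _ _ _ I.k_pos) <| forall₂_congr fun i hi => ?_
  rw [profile_of_two_le _ _ _ hi, le_publicValuation_iff]

theorem bundle_subset_contested {A : Allocation n m}
    (hA : ∀ i : Fin n, 2 ≤ (i : ℕ) → I.reserved i ∈ A.bundle i) {j : Fin n} (hj : (j : ℕ) < 2) :
    A.bundle j ⊆ I.contested := by
  intro g hg
  by_contra hgP
  obtain ⟨i, hi, rfl⟩ := I.reserved_bijOn.surjOn (by simpa using hgP)
  have hgi := hA i hi
  rw [mem_bundle_iff] at hg hgi
  exact hj.not_ge (hg ▸ hgi.symm ▸ hi)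

theorem not_disjoint_of_isProp (hc : c * (I.topValue / n) = 2 * k) {A : Allocation n m}
    (hA : IsProp c (I.profile x y) A) : ¬ Disjoint x y := by
  obtain ⟨hleft, hright, hpublic⟩ := (I.isProp_profile_iff hc A).1 hA
  have hS := I.bundle_subset_contested hpublic (j := I.left) (by simp [left])
  have hT := I.bundle_subset_contested hpublic (j := I.right) (by simp [right])
  have hkS := (hleft hS).elim le_of_lt fun h => h.1.ge
  have hkT := (hright hT).elim le_of_lt fun h => h.1.ge
  have hdisj : Disjoint (A.bundle I.left) (A.bundle I.right) :=
    disjoint_filter.2 fun _ _ h h' => I.left_ne_right (h.symm.trans h')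
  have hcompl := eq_sdiff_of_disjoint_of_le_card I.card_contested hS hT hdisj hkS hkT
  have hcard := card_sdiff_add_card_eq_card hS
  rw [← hcompl, I.card_contested] at hcard
  obtain ⟨S, hSx, hSleft⟩ := mem_image.1 ((hleft hS).resolve_left (by omega)).2
  obtain ⟨T, hTy, hTright⟩ := mem_image.1 ((hright hT).resolve_left (by omega)).2
  have hST : T = S := Subtype.ext <| by
    rw [← Finset.sdiff_sdiff_eq_self (mem_powersetCard.1 T.2).1, hTright, hcompl,
      Finset.sdiff_sdiff_eq_self hS, hSleft]
  exact not_disjoint_iff.2 ⟨S, hSx, hST ▸ hTy⟩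

/-- The allocation that gives the items in `S` to the first player, the other contested items to the
second one, and to everyone else the item reserved for that player. -/
noncomputable def splitting (S : Finset (Fin m)) : Allocation n m := fun g =>
  haveI : Nonempty (Fin n) := ⟨I.left⟩
  if g ∈ S then I.left
  else if g ∈ I.contested then I.right
  else Function.invFunOn I.reserved {i | 2 ≤ (i : ℕ)} g

theorem reserved_mem_bundle_splitting {S : Finset (Fin m)} (hS : S ⊆ I.contested) {i : Fin n}
    (hi : 2 ≤ (i : ℕ)) : I.reserved i ∈ (I.splitting S).bundle i := by
  have : Nonempty (Fin n) := ⟨I.left⟩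
  have hiP := I.reserved_notMem_contested hi
  simpa only [mem_bundle_iff, splitting, if_neg hiP, if_neg fun h => hiP (hS h)]
    using I.reserved_bijOn.injOn.leftInvOn_invFunOn hi

theorem bundle_left_splitting {S : Finset (Fin m)} (hS : S ⊆ I.contested) :
    (I.splitting S).bundle I.left = S := by
  have hP := I.bundle_subset_contested (fun _ => I.reserved_mem_bundle_splitting hS) (j := I.left)
    (by simp [left])
  have := I.left_ne_right
  ext g
  have := @hP g
  simp only [mem_bundle_iff, splitting] at this ⊢
  grind

theorem bundle_right_splitting {S : Finset (Fin m)} (hS : S ⊆ I.contested) :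
    (I.splitting S).bundle I.right = I.contested \ S := by
  have hP := I.bundle_subset_contested (fun _ => I.reserved_mem_bundle_splitting hS) (j := I.right)
    (by simp [right])
  have := I.left_ne_right
  ext g
  have := @hP g
  simp only [mem_bundle_iff, splitting] at this ⊢
  grind

theorem exists_isProp_of_not_disjoint (hc : c * (I.topValue / n) = 2 * k) (hxy : ¬ Disjoint x y) :
    ∃ A : Allocation n m, IsProp c (I.profile x y) A := by
  obtain ⟨⟨S, hS⟩, hSx, hSy⟩ := not_disjoint_iff.1 hxy
  obtain ⟨hSP, hSk⟩ := mem_powersetCard.1 hS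
  have hcard : #(I.contested \ S) = k := by
    rw [card_sdiff_of_subset hSP, I.card_contested]
    omega
  refine ⟨I.splitting S, (I.isProp_profile_iff hc _).2 ⟨fun _ => .inr ?_, fun _ => .inr ?_,
    fun _ => I.reserved_mem_bundle_splitting hSP⟩⟩
  · rw [I.bundle_left_splitting hSP]
    exact ⟨hSk, mem_image_of_mem _ hSx⟩
  · rw [I.bundle_right_splitting hSP]
    exact ⟨hcard, mem_image_of_mem _ hSy⟩

/-- A proportional allocation for the instance `(x, y)` is a common element of `x` and `y`. -/
def reduction (hc : c * (I.topValue / n) = 2 * k) :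
    DisjointnessReduction I.Half
      (fun i : Fin n => {v : Valuation m | v.Submodular ∧
        (∀ S, v.val S ∈ hardValues k I.topValue) ∧ (2 ≤ (i : ℕ) → v = I.publicValuation i)})
      (PropDecision c) where
  inp := I.profile
  inp_mem x y i := ⟨I.profile_submodular x y i, I.profile_mem_hardValues x y i,
    I.profile_of_two_le x y⟩
  inp_left_or_right i := by
    by_cases hi : i = I.left
    · exact .inl fun x y y' => by simp only [profile, if_pos hi]
    · exact .inr fun x x' y => by simp only [profile, if_neg hi]
  right_iff x y b := iff_congr Iff.rfl
    ⟨fun ⟨_, hA⟩ => I.not_disjoint_of_isProp hc hA, I.exists_isProp_of_not_disjoint hc⟩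

/-- The first `2 * k` items are contested, and player `i + 2` wants the item `2 * k + i`. -/
def standard {n k : ℕ} (hn : 2 < n) (hk : 0 < k) {V : ℝ} (hV : 2 * k ≤ V) :
    HardInstance n (2 * k + n - 2) k where
  two_lt := hn
  k_pos := hk
  contested := {g | (g : ℕ) < 2 * k}
  card_contested := by
    rw [Fin.card_filter_val_lt]
    omega
  reserved i := ⟨2 * k + (i - 2), by omega⟩
  reserved_bijOn := by
    refine ⟨fun i _ => by simp, fun i hi j hj hij => ?_, fun g hg => ?_⟩
    · simp only [Set.mem_ofPred_eq, Fin.ext_iff] at hi hj hij ⊢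
      omega
    · simp only [compl_filter, not_lt, coe_filter, mem_univ, true_and, Set.mem_ofPred_eq] at hg
      refine ⟨⟨g - 2 * k + 2, by omega⟩, by simp, Fin.ext ?_⟩
      simp only
      omega
  topValue := V
  le_topValue := hV

end HardInstance

end HardInstance

section Comparison

variable {n m : ℕ} {X O P : Type}

theorem randComplexity_mono {D D' : Fin n → Set X} (h : ∀ i, D i ⊆ D' i)
    (Right : (Fin n → X) → O → Prop) : randComplexity D Right ≤ randComplexity D' Right := by
  refine le_iInf₂ fun Γ hΓ => (iInf₂_le Γ fun x hx => hΓ x fun i => h i (hx i)).trans ?_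
  exact iSup_mono fun x => iSup_le fun hx => le_iSup_of_le (fun i => h i (hx i)) le_rfl

namespace Protocol

/-- The protocol that sends the same bits and applies `g` to the answer. -/
def mapAnswer (g : O → P) : Protocol n X O → Protocol n X P
  | declare i f => declare i (g ∘ f)
  | speak i f next => speak i f fun b => (next b).mapAnswer g

theorem answer_mapAnswer (g : O → P) (p : Protocol n X O) (x : Fin n → X) :
    (p.mapAnswer g).answer x = g (p.answer x) := by
  induction p with
  | declare i f => rfl
  | speak _ _ _ ih => exact ih _

theorem bits_mapAnswer (g : O → P) (p : Protocol n X O) (x : Fin n → X) :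
    (p.mapAnswer g).bits x = p.bits x := by
  induction p with
  | declare i f => rfl
  | speak _ _ _ ih => exact congrArg (· + 1) (ih _)

end Protocol

theorem randComplexity_le_of_forall_map [Countable O] (D : Fin n → Set X)
    {Right : (Fin n → X) → O → Prop} {Right' : (Fin n → X) → P → Prop} (g : O → P)
    (hg : ∀ x o, Right x o → Right' x (g o)) :
    randComplexity D Right' ≤ randComplexity D Right := by
  refine le_iInf₂ fun Γ hΓ => ?_
  let Γ' : RandProtocol n X P :=
    { det := fun ω => (Γ.det ω).mapAnswer g
      measurable_answer := fun x o => by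
        have : {ω | ((Γ.det ω).mapAnswer g).answer x = o} =
            ⋃ q ∈ {q : O | g q = o}, {ω | (Γ.det ω).answer x = q} := by
          ext ω
          simp [Protocol.answer_mapAnswer]
        rw [this]
        exact .biUnion (Set.to_countable _) fun q _ => Γ.measurable_answer x q }
  have hΓ' : Γ'.Correct D Right' := fun x hx =>
    (hΓ x hx).trans <| measure_mono fun ω hω => by
      simpa only [Set.mem_ofPred_eq, Γ', Protocol.answer_mapAnswer] using hg x _ hω
  refine (iInf₂_le Γ' hΓ').trans (le_of_eq ?_)
  simp only [RandProtocol.cost, Γ', Protocol.bits_mapAnswer]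

theorem randComplexity_propDecision_le (c : ℝ) (D : Fin n → Set (Valuation m)) :
    randComplexity D (PropDecision c) ≤ randComplexity D (PropSearch c) := by
  refine randComplexity_le_of_forall_map D Option.isSome fun v o ho => ?_
  cases o with
  | none => simpa [PropDecision, PropSearch] using ho
  | some A => exact ⟨fun _ => ⟨A, ho⟩, fun _ => rfl⟩

end Comparison

theorem four_hundred_lt_choose {k : ℕ} (hk : 6 ≤ k) : 400 < (2 * k).choose k := by
  rw [← Nat.centralBinom_eq_two_mul_choose]
  calc 400 < Nat.centralBinom 6 := by decide
    _ ≤ Nat.centralBinom k := Nat.centralBinom_strictMono.monotone hk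

theorem exists_choose_le_RSubmodPropDecisionPublic {n : ℕ} (hn : 2 < n) {c : ℝ} (hc : 0 < c)
    (hcn : c ≤ n) {k : ℕ} (hk : 6 ≤ k) :
    ∃ (w : Fin n → Valuation (2 * k + n - 2)) (L : Finset ℝ), #L ≤ 2 * k + n - 2 ∧
      ((1 / 800 : ℝ≥0) : ℝ≥0∞) * ((2 * k).choose k : ℝ≥0∞) ≤
        (RSubmodPropDecisionPublic n (2 * k + n - 2) c w L : ℝ≥0∞) := by
  have hV : (2 * k : ℝ) ≤ 2 * k * n / c := by
    rw [le_div_iff₀ hc]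
    gcongr
  let I := HardInstance.standard hn (by omega) hV
  have threshold : c * (I.topValue / n) = 2 * k := by
    have : (n : ℝ) ≠ 0 := by positivity
    simp only [I, HardInstance.standard]
    field_simp
  refine ⟨I.publicValuation, hardValues k I.topValue, (card_hardValues_le k _).trans (by omega), ?_⟩
  rw [← I.card_half]
  exact (I.reduction threshold).le_randComplexity (I.card_half ▸ four_hundred_lt_choose hk)

end FairDivision

theorem mainTheorem5_general {n : ℕ} (hn : 2 < n) {c : ℝ} (hc : 0 < c) (hcn : c ≤ n) {k : ℕ}
    (hk : 6 ≤ k) :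
    (((1 / 800 : ℝ≥0) : ℝ≥0∞) * ((2 * k).choose k : ℝ≥0∞) ≤
      (FairDivision.RSubmodPropDecision n (2 * k + n - 2) c : ℝ≥0∞)) ∧
    (((1 / 800 : ℝ≥0) : ℝ≥0∞) * ((2 * k).choose k : ℝ≥0∞) ≤
      (FairDivision.RSubmodProp n (2 * k + n - 2) c : ℝ≥0∞)) ∧
    (∃ (w : Fin n → FairDivision.Valuation (2 * k + n - 2)) (L : Finset ℝ),
      L.card ≤ 2 * k + n - 2 ∧
      ((1 / 800 : ℝ≥0) : ℝ≥0∞) * ((2 * k).choose k : ℝ≥0∞) ≤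
        (FairDivision.RSubmodPropDecisionPublic n (2 * k + n - 2) c w L : ℝ≥0∞)) := by
  obtain ⟨w, L, hL, hpublic⟩ :=
    FairDivision.exists_choose_le_RSubmodPropDecisionPublic hn hc hcn hk
  have public_le_decision : FairDivision.RSubmodPropDecisionPublic n (2 * k + n - 2) c w L ≤
      FairDivision.RSubmodPropDecision n (2 * k + n - 2) c :=
    FairDivision.randComplexity_mono (fun _ _ hv => hv.1) _
  have decision_le_search : FairDivision.RSubmodPropDecision n (2 * k + n - 2) c ≤
      FairDivision.RSubmodProp n (2 * k + n - 2) c :=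
    FairDivision.randComplexity_propDecision_le c _
  have hdecision := hpublic.trans (ENat.toENNReal_mono public_le_decision)
  exact ⟨hdecision, hdecision.trans (ENat.toENNReal_mono decision_le_search), w, L, hL, hpublic⟩

theorem mainTheorem5 :
    ∃ C : ℝ≥0, 0 < C ∧ ∃ K : ℕ, ∀ (n : ℕ), 2 < n → ∀ (c : ℝ), 0 < c → c ≤ 1 → ∀ (k : ℕ), K ≤ k →
      ((C : ℝ≥0∞) * ((2 * k).choose k : ℝ≥0∞) ≤
        (FairDivision.RSubmodPropDecision n (2 * k + n - 2) c : ℝ≥0∞)) ∧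
      ((C : ℝ≥0∞) * ((2 * k).choose k : ℝ≥0∞) ≤
        (FairDivision.RSubmodProp n (2 * k + n - 2) c : ℝ≥0∞)) ∧
      (∃ (w : Fin n → FairDivision.Valuation (2 * k + n - 2)) (L : Finset ℝ),
        L.card ≤ 2 * k + n - 2 ∧
        (C : ℝ≥0∞) * ((2 * k).choose k : ℝ≥0∞) ≤
          (FairDivision.RSubmodPropDecisionPublic n (2 * k + n - 2) c w L : ℝ≥0∞)) :=
  ⟨1 / 800, by positivity, 6, fun _ hn _ hc hc1 _ hk =>
    mainTheorem5_general hn hc (hc1.trans (by exact_mod_cast (by omega : 1 ≤ _))) hk⟩
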